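/- **Second trace formula for square integrable representations.** Let $G$ be a unimodular locally compact second countable Hausdorff topological group with Haar measure $\mu_G$, let $\mathcal H$ be a separable complex Hilbert space (inner product linear in the second argument), and let $U$ be a Borel projective representation of $G$ in $\mathcal H$: a map from $G$ to the unitary operators in $\mathcal H$ such that $g\mapsto\langle\phi,U(g)\psi\rangle$ is Borel for all $\phi,\psi\in\mathcal H$, $U(e)=I$, and $U(gh)=\mathtt m(g,h)\,U(g)U(h)$ for all $g,h\in G$, for some Borel function $\mathtt m\colon G\times G\to\mathbb T$. Put $c_{\psi,\phi}(g)=\langle U(g)\psi,\phi\rangle$ and $\mathcal A(U)=\{\psi\in\mathcal H : \exists\,\phi\neq0,\ c_{\psi,\phi}\in L^2(G,\mu_G)\}$. Assume that $U$ is square integrable, i.e. $U$ is irreducible and $\mathcal A(U)\neq\{0\}$. The Duflo–Moore operator $\hat D_U$ of $U$, normalized according to $\mu_G$, is the unique positive selfadjoint injective linear operator in $\mathcal H$ with domain $\mathcal A(U)$ such that $$\int_G \overline{c_{\psi_1,\phi_1}(g)}\,c_{\psi_2,\phi_2}(g)\,d\mu_G(g)=\langle\phi_1,\phi_2\rangle\,\langle\hat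 D_U\psi_2,\hat D_U\psi_1\rangle$$ for all $\phi_1,\phi_2\in\mathcal H$ and $\psi_1,\psi_2\in\mathcal A(U)$, the integrand being integrable. Then there is a number $d_U>0$ such that $\hat D_U$ exists, is unique, and equals $d_U I$ (with domain $\mathcal H$), and for all trace class operators $A,T$ in $\mathcal H$ the operators $U(g)\,T\,U(g)^*A$, $g\in G$, are of trace class, the function $g\mapsto\operatorname{tr}(U(g)\,T\,U(g)^*A)$ is $\mu_G$-integrable, and $$\operatorname{tr}(A)\operatorname{tr}(T)=d_U^{-2}\int_G\operatorname{tr}\big(U(g)\,T\,U(g)^*A\big)\,d\mu_G(g).$$ -/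

import Mathlib

open MeasureTheory
open scoped ENNReal NNReal InnerProductSpace

/-- The inner product of a complex inner product space. As a local instance it makes `⟪x, y⟫_ℂ`
refer to `InnerProductSpace` directly, not by way of Mathlib's C*-modules over `ℂ`. -/
abbrev hilbertInner (H : Type*) [NormedAddCommGroup H] [InnerProductSpace ℂ H] : Inner ℂ H :=
  InnerProductSpace.toInner

attribute [local instance] hilbertInner

noncomputable section TraceClass

variable (H : Type*) [NormedAddCommGroup H] [InnerProductSpace ℂ H] [CompleteSpace H]

/-- The index set of a fixed Hilbert (complete orthonormal) basis of `H`. -/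
def basisIndex : Set H := (exists_hilbertBasis ℂ H).choose

/-- A fixed Hilbert (complete orthonormal) basis of `H`. -/
def chosenBasis : HilbertBasis (basisIndex H) ℂ H :=
  (exists_hilbertBasis ℂ H).choose_spec.choose

variable {H}

/-- `A` is of trace class: `∑ᵢ ⟨eᵢ, |A| eᵢ⟩ < ∞`, where `|A| = (A* A)^{1/2}`. The terms are
nonnegative and, as `|A|` is positive, the sum does not depend on the orthonormal basis. -/
def IsTraceClass (A : H →L[ℂ] H) : Prop :=
  Summable fun i : basisIndex H =>
    RCLike.re ⟪chosenBasis H i, CFC.abs A (chosenBasis H i)⟫_ℂ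

/-- The trace `∑ᵢ ⟨eᵢ, A eᵢ⟩` of a trace class operator `A`; for such operators the sum converges
absolutely and does not depend on the orthonormal basis. -/
def opTrace (A : H →L[ℂ] H) : ℂ :=
  ∑' i : basisIndex H, ⟪chosenBasis H i, A (chosenBasis H i)⟫_ℂ

/-- The everywhere defined operator `d I`, as a (possibly unbounded) operator in `H`. -/
def scalarOperator (H : Type*) [NormedAddCommGroup H] [InnerProductSpace ℂ H] (d : ℝ) :
    H →ₗ.[ℂ] H :=
  ((d : ℂ) • (LinearMap.id : H →ₗ[ℂ] H)).toPMap ⊤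

end TraceClass

/-- A Borel projective representation of `G` in `H`. Since `G` will be second countable, the
product σ-algebra on `G × G` is the Borel one. -/
structure ProjectiveRep (G H : Type*) [Group G] [MeasurableSpace G]
    [NormedAddCommGroup H] [InnerProductSpace ℂ H] [CompleteSpace H] where
  toFun : G → unitary (H →L[ℂ] H)
  weaklyBorel : ∀ φ ψ : H, Measurable fun g => ⟪φ, (toFun g : H →L[ℂ] H) ψ⟫_ℂ
  map_one : toFun 1 = 1
  exists_multiplier : ∃ m : G × G → Circle, Measurable (fun p => (m p : ℂ)) ∧
    ∀ g h : G, (toFun (g * h) : H →L[ℂ] H) =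
      (m (g, h) : ℂ) • ((toFun g : H →L[ℂ] H) * (toFun h : H →L[ℂ] H))

namespace ProjectiveRep

variable {G H : Type*} [Group G] [MeasurableSpace G]
  [NormedAddCommGroup H] [InnerProductSpace ℂ H] [CompleteSpace H]

/-- The unitary operator `U(g)`, as a bounded operator. -/
noncomputable def op (U : ProjectiveRep G H) (g : G) : H →L[ℂ] H := (U.toFun g : H →L[ℂ] H)

/-- Irreducibility: `H ≠ 0`, and `{0}` and `H` are the only closed invariant subspaces. -/
def IsIrreducible (U : ProjectiveRep G H) : Prop :=
  Nontrivial H ∧ ∀ K : Submodule ℂ H, IsClosed (K : Set H) →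
    (∀ g : G, ∀ x ∈ K, U.op g x ∈ K) → K = ⊥ ∨ K = ⊤

/-- The coefficient `c_{ψ,φ} : g ↦ ⟨U(g) ψ, φ⟩`. -/
noncomputable def coeff (U : ProjectiveRep G H) (ψ φ : H) (g : G) : ℂ := ⟪U.op g ψ, φ⟫_ℂ

/-- The set `A(U)` of admissible vectors. -/
def admissible (U : ProjectiveRep G H) (μ : Measure G) : Set H :=
  {ψ | ∃ φ : H, φ ≠ 0 ∧ MemLp (U.coeff ψ φ) 2 μ}

/-- `U` is square integrable: it is irreducible and has a nonzero admissible vector. -/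
def IsSquareIntegrable (U : ProjectiveRep G H) (μ : Measure G) : Prop :=
  U.IsIrreducible ∧ U.admissible μ ≠ {0}

/-- `D` is the Duflo–Moore operator of `U`, normalized according to `μ`: a positive selfadjoint
injective operator with domain `A(U)` that satisfies the orthogonality relations. -/
structure IsDufloMoore (U : ProjectiveRep G H) (μ : Measure G) (D : H →ₗ.[ℂ] H) : Prop where
  selfAdjoint : IsSelfAdjoint D
  nonneg : ∀ ψ : D.domain, 0 ≤ RCLike.re ⟪(ψ : H), D ψ⟫_ℂ
  injective : Function.Injective D
  domain_eq : (D.domain : Set H) = U.admissible μ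
  orthogonality : ∀ (φ₁ φ₂ : H) (ψ₁ ψ₂ : D.domain),
    Integrable (fun g => star (U.coeff ψ₁ φ₁ g) * U.coeff ψ₂ φ₂ g) μ ∧
    ∫ g, star (U.coeff ψ₁ φ₁ g) * U.coeff ψ₂ φ₂ g ∂μ = ⟪φ₁, φ₂⟫_ℂ * ⟪D ψ₂, D ψ₁⟫_ℂ

end ProjectiveRep

/-!
Trace formula for square integrable representations of unimodular groups.

For fixed admissible `ψ`, the operator `φ ↦ c_{ψ,φ}` from `H` to `L²(G, μ)` is closed, and up to
phases it intertwines `U` with left translation. The projection `p` of its graph onto `H` is then an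
injective intertwiner, so `p p*` commutes with `U`; by irreducibility it is a scalar
(`ProjectiveRep.IsIrreducible.norm_sq_intertwiner`). Hence the operator is everywhere defined and
`∫ |c_{ψ,φ}|² = k(ψ) ‖φ‖²`.

Unimodularity makes `μ` inversion invariant, and `|c_{ψ,φ}(g⁻¹)| = |c_{φ,ψ}(g)|`, so the left
side is symmetric in `ψ` and `φ`. Therefore every vector is admissible and
`∫ |c_{ψ,φ}|² = K ‖ψ‖² ‖φ‖²` (`ProjectiveRep.IsSquareIntegrable.exists_integral_norm_coeff`);
`K > 0` because the coordinates of `U(g) ψ` in a countable basis cannot all vanish. Polarization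
gives the orthogonality relations with `d² = K` (`ProjectiveRep.integral_star_coeff_mul`), so that `d I` is a
Duflo–Moore operator. A positive symmetric everywhere defined `D` with `D² = d²` equals `d I`,
whence uniqueness.

By the polar decomposition, trace class operators are exactly those of the form
`A = ∑ᵢ |xᵢ⟩⟨yᵢ|` with `∑ᵢ ‖xᵢ‖ ‖yᵢ‖ < ∞`, and then `tr A = ∑ᵢ ⟪yᵢ, xᵢ⟫`. If also
`T = ∑ⱼ |uⱼ⟩⟨vⱼ|`, then `tr (U(g) T U(g)* A)` is the absolutely convergent sum over `i`, `j` of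
`conj c_{uⱼ,yᵢ}(g) · c_{vⱼ,xᵢ}(g)`. Integrating term by term with the orthogonality relations gives
`d² ∑ᵢⱼ ⟪yᵢ, xᵢ⟫ ⟪vⱼ, uⱼ⟫ = d² tr A · tr T` (`ProjectiveRep.integral_opTrace_conj_mul`).
-/

/-! ### Polar decomposition and trace class operators -/

section TraceClass

variable {H : Type*} [NormedAddCommGroup H] [InnerProductSpace ℂ H]

theorem HilbertBasis.hasSum_norm_inner_sq {κ : Type*} (b : HilbertBasis κ ℂ H) (x : H) :
    HasSum (fun k => ‖⟪b k, x⟫_ℂ‖ ^ 2) (‖x‖ ^ 2) := by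
  have h := Complex.hasSum_re (b.hasSum_inner_mul_inner x x)
  rw [show (⟪x, x⟫_ℂ).re = ‖x‖ ^ 2 from inner_self_eq_norm_sq (𝕜 := ℂ) x] at h
  convert h using 2 with k
  rw [← inner_conj_symm x (b k), RCLike.conj_mul]
  norm_cast

theorem HilbertBasis.tsum_norm_inner_mul_norm_inner_le {κ : Type*} (b : HilbertBasis κ ℂ H)
    (x y : H) : Summable (fun k => ‖⟪b k, x⟫_ℂ * ⟪y, b k⟫_ℂ‖) ∧
      ∑' k, ‖⟪b k, x⟫_ℂ * ⟪y, b k⟫_ℂ‖ ≤ ‖x‖ * ‖y‖ := by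
  have hx := b.hasSum_norm_inner_sq x
  have hy := b.hasSum_norm_inner_sq y
  have h := Real.summable_and_inner_le_Lp_mul_Lq_tsum_of_nonneg .two_two
    (f := fun k => ‖⟪b k, x⟫_ℂ‖) (g := fun k => ‖⟪b k, y⟫_ℂ‖)
    (fun _ => norm_nonneg _) (fun _ => norm_nonneg _)
    (by simpa using hx.summable) (by simpa using hy.summable)
  have hxy : ∀ k, ‖⟪b k, x⟫_ℂ * ⟪y, b k⟫_ℂ‖ = ‖⟪b k, x⟫_ℂ‖ * ‖⟪b k, y⟫_ℂ‖ := fun k => by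
    rw [norm_mul, norm_inner_symm y]
  simp_rw [hxy]
  refine ⟨h.1, h.2.trans_eq ?_⟩
  simp only [Real.rpow_two, hx.tsum_eq, hy.tsum_eq]
  rw [← Real.sqrt_eq_rpow, ← Real.sqrt_eq_rpow, Real.sqrt_sq (norm_nonneg _),
    Real.sqrt_sq (norm_nonneg _)]

/-- Distinct basis vectors are at distance `√2`, so the balls of radius `1 / 2` around them are
disjoint. -/
theorem HilbertBasis.countable_of_separableSpace {κ : Type*} [TopologicalSpace.SeparableSpace H]
    (b : HilbertBasis κ ℂ H) : Countable κ := by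
  have hd : Set.univ.PairwiseDisjoint fun k => Metric.ball (b k) (1 / 2) := by
    intro i _ j _ hij
    refine Metric.ball_disjoint_ball ?_
    have h : ‖b i - b j‖ ^ 2 = 2 := by
      rw [@norm_sub_sq ℂ, b.orthonormal.2 hij, b.orthonormal.1, b.orthonormal.1]
      norm_num
    rw [dist_eq_norm]
    nlinarith [norm_nonneg (b i - b j)]
  exact Set.countable_univ_iff.1
    (hd.countable_of_isOpen (fun _ _ => Metric.isOpen_ball) fun k _ => ⟨b k, by simp⟩)

/-- `x` and `y` form a nuclear expansion of `A`: `∑ᵢ ‖xᵢ‖ ‖yᵢ‖ < ∞` and `A = ∑ᵢ |xᵢ⟩⟨yᵢ|`, where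
`|x⟩⟨y|` is the operator `z ↦ ⟪y, z⟫ x`. Convergence is only asked for at each vector. -/
structure IsNuclearExpansion {ι : Type*} (A : H →L[ℂ] H) (x y : ι → H) : Prop where
  summable : Summable fun i => ‖x i‖ * ‖y i‖
  hasSum : ∀ z, HasSum (fun i => ⟪y i, z⟫_ℂ • x i) (A z)

namespace IsNuclearExpansion

variable {ι : Type*} {A : H →L[ℂ] H} {x y : ι → H}

theorem mul_left (h : IsNuclearExpansion A x y) (B : H →L[ℂ] H) :
    IsNuclearExpansion (B * A) (fun i => B (x i)) y where
  summable := by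
    refine .of_nonneg_of_le (fun _ => by positivity) (fun i => ?_) (h.summable.mul_left ‖B‖)
    rw [← mul_assoc]
    gcongr
    exact B.le_opNorm _
  hasSum z := by simpa using B.hasSum (h.hasSum z)

theorem summable_inner (h : IsNuclearExpansion A x y) :
    Summable fun i => ‖⟪y i, x i⟫_ℂ‖ :=
  .of_nonneg_of_le (fun _ => norm_nonneg _)
    (fun _ => (norm_inner_le_norm _ _).trans_eq (mul_comm _ _)) h.summable

/-- The trace does not depend on the basis: by Parseval in `k` and Cauchy–Schwarz the double series
`∑ᵢₖ ⟪bₖ, xᵢ⟫ ⟪yᵢ, bₖ⟫` converges absolutely. -/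
theorem hasSum_trace {κ : Type*} (h : IsNuclearExpansion A x y) (b : HilbertBasis κ ℂ H) :
    HasSum (fun k => ⟪b k, A (b k)⟫_ℂ) (∑' i, ⟪y i, x i⟫_ℂ) := by
  have hs : Summable fun p : ι × κ => ⟪b p.2, x p.1⟫_ℂ * ⟪y p.1, b p.2⟫_ℂ := by
    refine Summable.of_norm ((summable_prod_of_nonneg fun _ => norm_nonneg _).2 ⟨fun i =>
      (b.tsum_norm_inner_mul_norm_inner_le (x i) (y i)).1, ?_⟩)
    exact .of_nonneg_of_le (fun _ => tsum_nonneg fun _ => norm_nonneg _)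
      (fun i => (b.tsum_norm_inner_mul_norm_inner_le (x i) (y i)).2) h.summable
  have hi : ∀ i, HasSum (fun k => ⟪b k, x i⟫_ℂ * ⟪y i, b k⟫_ℂ) ⟪y i, x i⟫_ℂ := fun i => by
    simpa only [mul_comm] using b.hasSum_inner_mul_inner (y i) (x i)
  have hk : ∀ k, HasSum (fun i => ⟪b k, x i⟫_ℂ * ⟪y i, b k⟫_ℂ) ⟪b k, A (b k)⟫_ℂ := fun k => by
    simpa [inner_smul_right, mul_comm] using (innerSL ℂ (b k)).hasSum (h.hasSum (b k))
  have h1 := hs.hasSum.prod_fiberwise hi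
  have h2 := ((Equiv.prodComm κ ι).hasSum_iff.2 hs.hasSum).prod_fiberwise hk
  rwa [← h1.tsum_eq] at h2

end IsNuclearExpansion

variable [CompleteSpace H]

theorem ContinuousLinearMap.norm_cfcAbs_apply (A : H →L[ℂ] H) (x : H) :
    ‖CFC.abs A x‖ = ‖A x‖ := by
  have hsa : IsSelfAdjoint (CFC.abs A) := (CFC.abs_nonneg A).isSelfAdjoint
  have h : ⟪CFC.abs A x, CFC.abs A x⟫_ℂ = ⟪A x, A x⟫_ℂ := by
    rw [← ContinuousLinearMap.adjoint_inner_right, ← ContinuousLinearMap.star_eq_adjoint,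
      hsa.star_eq, ← mul_apply_eq_comp, CFC.abs_mul_abs,
      mul_apply_eq_comp, ContinuousLinearMap.star_eq_adjoint,
      ContinuousLinearMap.adjoint_inner_right]
  rw [inner_self_eq_norm_sq_to_K, inner_self_eq_norm_sq_to_K] at h
  have h2 : ‖CFC.abs A x‖ ^ 2 = ‖A x‖ ^ 2 := by exact_mod_cast h
  exact (pow_left_inj₀ (norm_nonneg _) (norm_nonneg _) two_ne_zero).1 h2

/-- Polar decomposition: `V` sends `|A| x` to `A x` on the closure of the range of `|A|`, and is
zero on the orthogonal complement. -/
theorem ContinuousLinearMap.exists_polar_decomposition (A : H →L[ℂ] H) :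
    ∃ V : H →L[ℂ] H, (∀ x, ‖V x‖ ≤ ‖x‖) ∧ V * CFC.abs A = A ∧ star V * A = CFC.abs A := by
  set p := CFC.abs A with hp
  let K : Submodule ℂ H := (LinearMap.range p.toLinearMap).topologicalClosure
  have hK : ∀ x, p x ∈ K := fun x => Submodule.le_topologicalClosure _ ⟨x, rfl⟩
  have : CompleteSpace K := (Submodule.isClosed_topologicalClosure _).completeSpace_coe
  let e : H →ₗ[ℂ] K := p.toLinearMap.codRestrict K hK
  have he : DenseRange e := by
    intro z
    rw [Metric.mem_closure_iff]
    intro ε hε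
    obtain ⟨_, ⟨x, rfl⟩, hx⟩ := Metric.mem_closure_iff.1 z.2 ε hε
    exact ⟨e x, ⟨x, rfl⟩, hx⟩
  have hb : ∀ x, ‖A.toLinearMap x‖ ≤ 1 * ‖e x‖ := fun x => by
    rw [one_mul]
    exact (A.norm_cfcAbs_apply x).ge
  let V₀ : K →L[ℂ] H := A.toLinearMap.extendOfNorm e
  have hV₀ : ∀ z, ‖V₀ z‖ ≤ ‖z‖ := fun z => by
    simpa using LinearMap.norm_extendOfNorm_apply_le he 1 hb z
  let V : H →L[ℂ] H := V₀ ∘L K.orthogonalProjectionOnto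
  have hV : ∀ x, ‖V x‖ ≤ ‖x‖ := fun x =>
    (hV₀ _).trans (K.norm_orthogonalProjectionOnto_apply_le x)
  have hVp : ∀ x, V (p x) = A x := fun x => by
    have h1 : K.orthogonalProjectionOnto (p x) = e x :=
      K.orthogonalProjectionOnto_mem_subspace_eq_self ⟨p x, hK x⟩
    change V₀ (K.orthogonalProjectionOnto (p x)) = A x
    rw [h1]
    exact LinearMap.extendOfNorm_eq he ⟨1, hb⟩ x
  have hVs : ∀ x, ‖(star V) x‖ ≤ ‖x‖ := fun x => by
    have h1 : ‖star V‖ ≤ 1 := by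
      rw [norm_star]
      exact V.opNorm_le_bound zero_le_one fun x => by simpa using hV x
    simpa using (star V).le_of_opNorm_le h1 x
  refine ⟨V, hV, ContinuousLinearMap.ext hVp, ContinuousLinearMap.ext fun x => ?_⟩
  -- `V` is isometric at `p x`, and a contraction satisfies `V* V z = z` where it is isometric.
  have hn : ‖V (p x)‖ = ‖p x‖ := by rw [hVp, hp, A.norm_cfcAbs_apply]
  have h2 : ‖star V (V (p x)) - p x‖ ^ 2 ≤ 0 := by
    rw [@norm_sub_sq ℂ, ContinuousLinearMap.star_eq_adjoint,
      ContinuousLinearMap.adjoint_inner_left, inner_self_eq_norm_sq,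
      ← ContinuousLinearMap.star_eq_adjoint]
    have := hVs (V (p x))
    nlinarith [norm_nonneg (star V (V (p x)))]
  have h3 : star V (V (p x)) = p x :=
    sub_eq_zero.1 (norm_eq_zero.1 (pow_eq_zero_iff two_ne_zero |>.1
      (le_antisymm h2 (by positivity))))
  rw [hVp] at h3
  exact h3

namespace IsNuclearExpansion

variable {ι : Type*} {A : H →L[ℂ] H} {x y : ι → H}

theorem mul_right (h : IsNuclearExpansion A x y) (B : H →L[ℂ] H) :
    IsNuclearExpansion (A * B) x (fun i => star B (y i)) where
  summable := by
    refine .of_nonneg_of_le (fun _ => by positivity) (fun i => ?_) (h.summable.mul_left ‖star B‖)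
    rw [mul_left_comm]
    gcongr
    exact (star B).le_opNorm _
  hasSum z := by
    simpa [ContinuousLinearMap.star_eq_adjoint, ContinuousLinearMap.adjoint_inner_left]
      using h.hasSum (B z)

theorem opTrace_eq (h : IsNuclearExpansion A x y) : opTrace A = ∑' i, ⟪y i, x i⟫_ℂ :=
  (h.hasSum_trace (chosenBasis H)).tsum_eq

/-- `|A| = V* A` again has a nuclear expansion, so its trace converges. -/
theorem isTraceClass (h : IsNuclearExpansion A x y) : IsTraceClass A := by
  obtain ⟨V, -, -, hV⟩ := A.exists_polar_decomposition
  have := h.mul_left (star V)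
  rw [hV] at this
  exact (Complex.hasSum_re (this.hasSum_trace (chosenBasis H))).summable

end IsNuclearExpansion

/-- With `S = |A|^{1/2}` and the polar decomposition, `A = V S S = ∑ᵢ |V S eᵢ⟩⟨S eᵢ|`, where
`∑ᵢ ‖S eᵢ‖² = tr |A|`. -/
theorem IsTraceClass.exists_isNuclearExpansion {A : H →L[ℂ] H} (hA : IsTraceClass A) :
    ∃ x y : basisIndex H → H, IsNuclearExpansion A x y := by
  obtain ⟨V, hV, hVA, -⟩ := A.exists_polar_decomposition
  set S := CFC.sqrt (CFC.abs A) with hS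
  have hSS : S * S = CFC.abs A := CFC.sqrt_mul_sqrt_self _ (CFC.abs_nonneg A)
  have hsa : IsSelfAdjoint S := (CFC.sqrt_nonneg _).isSelfAdjoint
  have hsym : ∀ u v, ⟪S u, v⟫_ℂ = ⟪u, S v⟫_ℂ := fun u v => by
    rw [← ContinuousLinearMap.adjoint_inner_right, ← ContinuousLinearMap.star_eq_adjoint,
      hsa.star_eq]
  set b := chosenBasis H
  have hsum : Summable fun i => ‖S (b i)‖ * ‖S (b i)‖ := by
    refine hA.congr fun i => ?_
    rw [← hSS, mul_apply_eq_comp, ← hsym, inner_self_eq_norm_mul_norm]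
  refine ⟨fun i => V (S (b i)), fun i => S (b i), ?_, fun z => ?_⟩
  · exact .of_nonneg_of_le (fun _ => by positivity)
      (fun i => mul_le_mul_of_nonneg_right (hV _) (norm_nonneg _)) hsum
  · have h := (V * S).hasSum (b.hasSum_repr (S z))
    rw [mul_apply_eq_comp, ← mul_apply_eq_comp S, hSS,
      ← mul_apply_eq_comp V, hVA] at h
    simpa [hsym, b.repr_apply_apply] using h

end TraceClass

/-! ### Schur's lemma -/

section Schur

variable {G H : Type*} [Group G] [MeasurableSpace G]
  [NormedAddCommGroup H] [InnerProductSpace ℂ H] [CompleteSpace H] {U : ProjectiveRep G H}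

theorem ProjectiveRep.inner_op_op (U : ProjectiveRep G H) (g : G) (u v : H) :
    ⟪U.op g u, U.op g v⟫_ℂ = ⟪u, v⟫_ℂ := by
  rw [← ContinuousLinearMap.adjoint_inner_right, ← ContinuousLinearMap.star_eq_adjoint,
    ← mul_apply_eq_comp]
  simp [ProjectiveRep.op]

/-- **Schur's lemma.** If the spectrum had two points, two continuous functions separating them
with product `0` would give operators `F`, `E ≠ 0` in the commutant with `F E = 0`, and `ker F`
would be a nontrivial closed invariant subspace. -/
theorem ProjectiveRep.IsIrreducible.exists_eq_smul_one (hU : U.IsIrreducible) {B : H →L[ℂ] H}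
    (hB : IsSelfAdjoint B) (hc : ∀ g, Commute B (U.op g)) : ∃ c : ℝ, B = c • 1 := by
  have := hU.1
  obtain ⟨c, hcs⟩ := ContinuousFunctionalCalculus.spectrum_nonempty (R := ℝ) B hB
  refine ⟨c, ?_⟩
  suffices h : ∀ x ∈ spectrum ℝ B, x = c by
    rw [← cfc_id' ℝ B, cfc_congr (g := fun _ => c) h, cfc_const c B, Algebra.algebraMap_eq_smul_one]
  intro x hx
  by_contra hxc
  -- Tents of height and radius `|x - c| / 2` around `x` and `c` have disjoint supports.
  let bump : ℝ → ℝ → ℝ := fun y t => max 0 (|x - c| / 2 - |t - y|)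
  have hpos : 0 < |x - c| / 2 := by
    have := abs_pos.2 (sub_ne_zero.2 hxc)
    positivity
  have hcont : ∀ y, Continuous (bump y) := fun y => by fun_prop
  have hne : ∀ y ∈ spectrum ℝ B, cfc (bump y) B ≠ 0 := by
    intro y hy h0
    have h1 : bump y y ∈ spectrum ℝ (cfc (bump y) B) := by
      rw [cfc_map_spectrum (bump y) B hB (hcont y).continuousOn]
      exact ⟨y, hy, rfl⟩
    rw [h0, spectrum.zero_eq, Set.mem_singleton_iff] at h1
    simp only [bump, sub_self, abs_zero, sub_zero, max_eq_right hpos.le] at h1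
    exact hpos.ne' h1
  have hmul : cfc (bump x) B * cfc (bump c) B = 0 := by
    rw [← cfc_mul (bump x) (bump c) B (hcont x).continuousOn (hcont c).continuousOn,
      ← cfc_zero ℝ B]
    congr 1
    ext t
    have htri := abs_sub_le x t c
    rw [abs_sub_comm x t] at htri
    simp only [bump, Pi.zero_apply, mul_eq_zero, max_eq_left_iff]
    by_contra! h
    linarith [h.1, h.2]
  have hcomm : ∀ g, Commute (cfc (bump x) B) (U.op g) := fun g => (hc g).cfc_real _
  rcases hU.2 (LinearMap.ker (cfc (bump x) B).toLinearMap) (ContinuousLinearMap.isClosed_ker _)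
    (fun g z hz => by
      have := DFunLike.congr_fun (hcomm g).eq z
      simp only [mul_apply_eq_comp] at this
      simp only [LinearMap.mem_ker, ContinuousLinearMap.coe_coe] at hz ⊢
      rw [this, hz, map_zero]) with h | h
  · refine hne c hcs (ContinuousLinearMap.ext fun z => ?_)
    have : cfc (bump c) B z ∈ LinearMap.ker (cfc (bump x) B).toLinearMap :=
      DFunLike.congr_fun hmul z
    rwa [h, Submodule.mem_bot] at this
  · refine hne x hx (ContinuousLinearMap.ext fun z => ?_)
    have : z ∈ LinearMap.ker (cfc (bump x) B).toLinearMap := h ▸ Submodule.mem_top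
    exact this

/-- Schur's lemma for an injective intertwiner `p` from another Hilbert space: `p p*` commutes with
`U`, so it is a scalar, and `p` is a multiple of a unitary. -/
theorem ProjectiveRep.IsIrreducible.norm_sq_intertwiner (hU : U.IsIrreducible) {E : Type*}
    [NormedAddCommGroup E] [InnerProductSpace ℂ E] [CompleteSpace E] (p : E →L[ℂ] H)
    (hinj : Function.Injective p) (hp : p ≠ 0) (S : G → E → E)
    (hsurj : ∀ g, Function.Surjective (S g))
    (hS : ∀ g x y, ⟪S g x, S g y⟫_ℂ = ⟪x, y⟫_ℂ) (hpS : ∀ g x, p (S g x) = U.op g (p x)) :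
    ∃ c : ℝ, 0 < c ∧ Function.Surjective p ∧ ∀ x, ‖p x‖ ^ 2 = c * ‖x‖ ^ 2 := by
  have hadj : ∀ g x, p.adjoint (U.op g x) = S g (p.adjoint x) := by
    intro g x
    refine ext_inner_left ℂ fun y => ?_
    obtain ⟨y, rfl⟩ := hsurj g y
    rw [ContinuousLinearMap.adjoint_inner_right, hpS, U.inner_op_op, hS,
      ContinuousLinearMap.adjoint_inner_right]
  obtain ⟨c, hc⟩ := hU.exists_eq_smul_one (B := p ∘L p.adjoint)
    (by rw [ContinuousLinearMap.isSelfAdjoint_iff', ContinuousLinearMap.adjoint_comp,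
          ContinuousLinearMap.adjoint_adjoint])
    (fun g => ContinuousLinearMap.ext fun x => by
      simp [hadj, hpS])
  have hpp : ∀ x, p (p.adjoint x) = c • x := fun x => by
    simpa using DFunLike.congr_fun hc x
  have hpp' : ∀ x, p.adjoint (p x) = c • x := fun x => hinj (by
    rw [hpp, ContinuousLinearMap.map_smul_of_tower])
  have hnorm : ∀ x, ‖p x‖ ^ 2 = c * ‖x‖ ^ 2 := fun x => by
    have h : ⟪p x, p x⟫_ℂ = c • ⟪x, x⟫_ℂ := by
      rw [← ContinuousLinearMap.adjoint_inner_right, hpp', inner_smul_right_eq_smul]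
    rw [inner_self_eq_norm_sq_to_K, inner_self_eq_norm_sq_to_K] at h
    have h2 := congrArg Complex.re h
    norm_cast at h2
  obtain ⟨x, hx⟩ : ∃ x, p x ≠ 0 := by
    by_contra! h
    exact hp (ContinuousLinearMap.ext h)
  have hc0 : 0 < c := by
    by_contra! h
    have h1 : 0 < ‖p x‖ ^ 2 := by positivity
    nlinarith [hnorm x, sq_nonneg ‖x‖]
  refine ⟨c, hc0, fun y => ⟨c⁻¹ • p.adjoint y, ?_⟩, hnorm⟩
  rw [ContinuousLinearMap.map_smul_of_tower, hpp, smul_smul, inv_mul_cancel₀ hc0.ne', one_smul]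

end Schur

/-! ### Haar measure of a unimodular group -/

section Haar

open Measure

variable {G : Type*} [Group G] [TopologicalSpace G] [IsTopologicalGroup G]
  [LocallyCompactSpace G] [SecondCountableTopology G] [MeasurableSpace G] [BorelSpace G]
  (μ : Measure G) [μ.IsHaarMeasure]

theorem MeasureTheory.Measure.isMulRightInvariant_of_modularCharacter_eq_one
    (hG : ∀ g : G, modularCharacter g = 1) : μ.IsMulRightInvariant where
  map_mul_right_eq_self g := by
    have h := isMulLeftInvariant_eq_smul (map (· * g) μ) μ
    rwa [← modularCharacterFun_eq_haarScalarFactor μ g,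
      show modularCharacterFun g = 1 from hG g, one_smul] at h

/-- By uniqueness of Haar measure the inverse of `μ` is `c μ`, and `c ^ 2 = 1` since inversion is an
involution. -/
theorem MeasureTheory.Measure.isInvInvariant_of_isMulRightInvariant
    [μ.IsMulRightInvariant] : μ.IsInvInvariant := by
  constructor
  have : IsFiniteMeasureOnCompacts μ.inv := ⟨fun K hK => by
    rw [inv_apply]
    exact hK.inv.measure_lt_top⟩
  let c : ℝ≥0∞ := haarScalarFactor μ.inv μ
  have hc : μ.inv = c • μ := isMulLeftInvariant_eq_smul μ.inv μ
  have h2 : μ = c ^ 2 • μ := by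
    calc μ = μ.inv.inv := μ.inv_inv.symm
      _ = c ^ 2 • μ := by
        rw [hc, inv_def, Measure.map_smul, ← inv_def, hc, smul_smul, pow_two]
  have K : TopologicalSpace.PositiveCompacts G := Classical.arbitrary _
  have h3 : c ^ 2 * μ K = 1 ^ 2 * μ K := by
    conv_rhs => rw [h2]
    simp
  have h4 : c ^ 2 = 1 ^ 2 :=
    (ENNReal.mul_left_inj (measure_pos_of_nonempty_interior _ K.interior_nonempty).ne'
      K.isCompact.measure_lt_top.ne).1 h3
  have h5 : c = 1 := (ENNReal.pow_right_strictMono two_ne_zero).injective h4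
  rw [hc, h5, one_smul]

end Haar

/-! ### Square integrable coefficients -/

namespace ProjectiveRep

section Coeff

variable {G H : Type*} [Group G] [MeasurableSpace G]
  [NormedAddCommGroup H] [InnerProductSpace ℂ H] [CompleteSpace H] (U : ProjectiveRep G H)

theorem norm_op_apply (g : G) (u : H) : ‖U.op g u‖ = ‖u‖ := by
  rw [@norm_eq_sqrt_re_inner ℂ, @norm_eq_sqrt_re_inner ℂ _ _ _ _ u, inner_op_op]

theorem measurable_coeff (ψ φ : H) : Measurable (U.coeff ψ φ) := by
  have h : U.coeff ψ φ = fun g => star ⟪φ, U.op g ψ⟫_ℂ :=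
    funext fun g => (inner_conj_symm _ _).symm
  rw [h]
  exact continuous_star.measurable.comp (U.weaklyBorel φ ψ)

theorem norm_coeff_le (ψ φ : H) (g : G) : ‖U.coeff ψ φ g‖ ≤ ‖ψ‖ * ‖φ‖ :=
  (norm_inner_le_norm _ _).trans_eq (by rw [norm_op_apply])

theorem coeff_add_right (ψ φ φ' : H) : U.coeff ψ (φ + φ') = U.coeff ψ φ + U.coeff ψ φ' :=
  funext fun _ => inner_add_right _ _ _

theorem coeff_smul_right (ψ φ : H) (c : ℂ) : U.coeff ψ (c • φ) = c • U.coeff ψ φ :=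
  funext fun _ => inner_smul_right _ _ _

theorem coeff_add_left (ψ ψ' φ : H) : U.coeff (ψ + ψ') φ = U.coeff ψ φ + U.coeff ψ' φ :=
  funext fun _ => by simp [coeff, inner_add_left]

theorem coeff_smul_left (ψ φ : H) (c : ℂ) : U.coeff (c • ψ) φ = star c • U.coeff ψ φ :=
  funext fun _ => by simp [coeff, inner_smul_left]

/-- Translation of `φ` by `U(h)` is left translation of the coefficient, up to phases which do not
depend on `φ`. -/
theorem exists_coeff_op (ψ : H) (h : G) : ∃ z : G → Circle, ∀ φ g,
    U.coeff ψ (U.op h φ) g = z g * U.coeff ψ φ (h⁻¹ * g) := by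
  obtain ⟨m, -, hm⟩ := U.exists_multiplier
  refine ⟨fun g => (m (h, h⁻¹ * g))⁻¹, fun φ g => ?_⟩
  have h1 := hm h (h⁻¹ * g)
  rw [mul_inv_cancel_left] at h1
  have h2 : U.op g ψ = (m (h, h⁻¹ * g) : ℂ) • U.op h (U.op (h⁻¹ * g) ψ) := DFunLike.congr_fun h1 ψ
  rw [coeff, h2, inner_smul_left, inner_op_op, coeff, ← Circle.coe_inv_eq_conj]

/-- Up to a phase `U(g⁻¹)` is `U(g)*`, so inversion exchanges the two vectors of a coefficient. -/
theorem norm_coeff_inv (ψ φ : H) (g : G) : ‖U.coeff ψ φ g⁻¹‖ = ‖U.coeff φ ψ g‖ := by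
  obtain ⟨z, hz⟩ := U.exists_coeff_op ψ g
  have h := congrArg norm (hz φ 1)
  rw [mul_one, norm_mul, Circle.norm_coe, one_mul] at h
  rw [← h, coeff, coeff, norm_inner_symm]
  simp [op, U.map_one]

variable {μ : Measure G}

theorem integral_star_coeff_mul_self (ψ φ : H) :
    ∫ g, star (U.coeff ψ φ g) * U.coeff ψ φ g ∂μ = ((∫ g, ‖U.coeff ψ φ g‖ ^ 2 ∂μ : ℝ) : ℂ) := by
  rw [← integral_complex_ofReal]
  congr 1 with g
  rw [RCLike.star_def, RCLike.conj_mul]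
  norm_cast

/-- The graph of the closed operator `φ ↦ c_{ψ,φ}` from `H` to `L²(G, μ)`, as a subspace of the
Hilbert sum of `H` and `L²(G, μ)`. -/
noncomputable def coeffGraph (U : ProjectiveRep G H) (μ : Measure G) (ψ : H) :
    Submodule ℂ (WithLp 2 (H × Lp ℂ 2 μ)) where
  carrier := {x | x.snd =ᵐ[μ] U.coeff ψ x.fst}
  zero_mem' := by
    have h : U.coeff ψ 0 = 0 := by simpa using U.coeff_smul_right ψ 0 0
    simpa [h] using Lp.coeFn_zero ℂ 2 μ
  add_mem' {x y} hx hy := by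
    simp only [Set.mem_ofPred_eq, WithLp.add_fst, WithLp.add_snd, coeff_add_right] at hx hy ⊢
    exact (Lp.coeFn_add _ _).trans (hx.add hy)
  smul_mem' c x hx := by
    simp only [Set.mem_ofPred_eq, WithLp.smul_fst, WithLp.smul_snd, coeff_smul_right] at hx ⊢
    exact (Lp.coeFn_smul _ _).trans (hx.const_smul c)

theorem mem_coeffGraph {ψ : H} {x : WithLp 2 (H × Lp ℂ 2 μ)} :
    x ∈ U.coeffGraph μ ψ ↔ x.snd =ᵐ[μ] U.coeff ψ x.fst := Iff.rfl

/-- An `L²`-convergent sequence has a subsequence that converges almost everywhere, while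
`c_{ψ,φ}(g)` is continuous in `φ`. -/
theorem isClosed_coeffGraph (ψ : H) :
    IsClosed (U.coeffGraph μ ψ : Set (WithLp 2 (H × Lp ℂ 2 μ))) := by
  refine IsSeqClosed.isClosed fun x y hx hxy => ?_
  have hfst : Filter.Tendsto (fun n => (x n).fst) .atTop (nhds y.fst) :=
    (WithLp.continuous_fst 2 _ _).continuousAt.tendsto.comp hxy
  have hsnd : Filter.Tendsto (fun n => (x n).snd) .atTop (nhds y.snd) :=
    (WithLp.continuous_snd 2 _ _).continuousAt.tendsto.comp hxy
  obtain ⟨ns, hns, hae⟩ := (tendstoInMeasure_of_tendsto_Lp hsnd).exists_seq_tendsto_ae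
  have hmem : ∀ᵐ g ∂μ, ∀ n, (x n).snd g = U.coeff ψ (x n).fst g := ae_all_iff.2 hx
  filter_upwards [hae, hmem] with g hg hg'
  refine tendsto_nhds_unique hg ?_
  simp_rw [hg']
  have hc : Continuous fun φ => U.coeff ψ φ g := by unfold coeff; fun_prop
  exact hc.continuousAt.tendsto.comp (hfst.comp hns.tendsto_atTop)

/-- The graph inner product, in terms of the coefficients themselves. -/
theorem inner_coeffGraph {ψ : H} (x y : U.coeffGraph μ ψ) :
    ⟪x, y⟫_ℂ = ⟪x.1.fst, y.1.fst⟫_ℂ +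
      ∫ g, star (U.coeff ψ x.1.fst g) * U.coeff ψ y.1.fst g ∂μ := by
  rw [Submodule.coe_inner, WithLp.prod_inner_apply, L2.inner_def]
  congr 1
  refine integral_congr_ae ?_
  filter_upwards [x.2, y.2] with g hx hy
  rw [show x.1.ofLp.2 g = _ from hx, show y.1.ofLp.2 g = _ from hy, RCLike.inner_apply, mul_comm]
  rfl

theorem memLp_of_coeffGraph {ψ : H} (x : U.coeffGraph μ ψ) : MemLp (U.coeff ψ x.1.fst) 2 μ :=
  (memLp_congr_ae x.2).1 (Lp.memLp _)

/-- The point of `coeffGraph` over `φ`. -/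
noncomputable def toCoeffGraph {ψ φ : H} (h : MemLp (U.coeff ψ φ) 2 μ) : U.coeffGraph μ ψ :=
  ⟨WithLp.toLp 2 (φ, h.toLp _), h.coeFn_toLp⟩

theorem coeffGraph_ext {ψ : H} {x y : U.coeffGraph μ ψ} (h : x.1.fst = y.1.fst) : x = y := by
  refine Subtype.ext (WithLp.ofLp_injective 2 (Prod.ext h (Lp.ext ?_)))
  have hx := U.mem_coeffGraph.1 x.2
  rw [h] at hx
  exact hx.trans (U.mem_coeffGraph.1 y.2).symm

variable [TopologicalSpace G] [IsTopologicalGroup G] [BorelSpace G]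

theorem memLp_coeff_op_iff [μ.IsMulLeftInvariant] (ψ φ : H) (h : G) :
    MemLp (U.coeff ψ (U.op h φ)) 2 μ ↔ MemLp (U.coeff ψ φ) 2 μ := by
  obtain ⟨z, hz⟩ := U.exists_coeff_op ψ h
  constructor <;> intro hm
  · refine (hm.comp_measurePreserving (measurePreserving_mul_left μ h)).congr_norm
      (U.measurable_coeff ψ φ).aestronglyMeasurable (.of_forall fun g => ?_)
    rw [Function.comp_apply, hz, norm_mul, Circle.norm_coe, one_mul, inv_mul_cancel_left]
  · refine (hm.comp_measurePreserving (measurePreserving_mul_left μ h⁻¹)).congr_norm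
      (U.measurable_coeff ψ _).aestronglyMeasurable (.of_forall fun g => ?_)
    rw [Function.comp_apply, hz, norm_mul, Circle.norm_coe, one_mul]

theorem integral_coeff_op [μ.IsMulLeftInvariant] (ψ φ φ' : H) (h : G) :
    ∫ g, star (U.coeff ψ (U.op h φ) g) * U.coeff ψ (U.op h φ') g ∂μ =
      ∫ g, star (U.coeff ψ φ g) * U.coeff ψ φ' g ∂μ := by
  obtain ⟨z, hz⟩ := U.exists_coeff_op ψ h
  rw [← integral_mul_left_eq_self (fun g => star (U.coeff ψ φ g) * U.coeff ψ φ' g) h⁻¹]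
  congr 1 with g
  have hz1 : star (z g : ℂ) * z g = 1 := by
    rw [RCLike.star_def, RCLike.conj_mul, Circle.norm_coe]
    norm_num
  rw [hz, hz, star_mul']
  linear_combination (star (U.coeff ψ φ (h⁻¹ * g)) * U.coeff ψ φ' (h⁻¹ * g)) * hz1

theorem memLp_coeff_swap [μ.IsInvInvariant] {ψ φ : H} (h : MemLp (U.coeff ψ φ) 2 μ) :
    MemLp (U.coeff φ ψ) 2 μ :=
  (h.comp_measurePreserving (μ.measurePreserving_inv)).congr_norm
    (U.measurable_coeff φ ψ).aestronglyMeasurable (.of_forall fun g => U.norm_coeff_inv ψ φ g)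

theorem integral_norm_coeff_swap [μ.IsInvInvariant] (ψ φ : H) :
    ∫ g, ‖U.coeff φ ψ g‖ ^ 2 ∂μ = ∫ g, ‖U.coeff ψ φ g‖ ^ 2 ∂μ := by
  rw [← integral_inv_eq_self (fun g => ‖U.coeff ψ φ g‖ ^ 2)]
  simp_rw [norm_coeff_inv]

/-- Schur's lemma for `φ ↦ c_{ψ,φ}`: for admissible `ψ` this operator is everywhere defined and a
multiple of an isometry. -/
theorem IsIrreducible.exists_integral_norm_coeff [μ.IsMulLeftInvariant] {U : ProjectiveRep G H}
    (hU : U.IsIrreducible) {ψ : H} (hψ : ψ ∈ U.admissible μ) :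
    ∃ k : ℝ, ∀ φ, MemLp (U.coeff ψ φ) 2 μ ∧ ∫ g, ‖U.coeff ψ φ g‖ ^ 2 ∂μ = k * ‖φ‖ ^ 2 := by
  obtain ⟨φ₀, hφ₀, hm₀⟩ := hψ
  have : CompleteSpace (U.coeffGraph μ ψ) := (U.isClosed_coeffGraph ψ).completeSpace_coe
  let p : U.coeffGraph μ ψ →L[ℂ] H := WithLp.fstL 2 ℂ H (Lp ℂ 2 μ) ∘L (U.coeffGraph μ ψ).subtypeL
  have hS (g : G) (x : U.coeffGraph μ ψ) : MemLp (U.coeff ψ (U.op g x.1.fst)) 2 μ :=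
    (U.memLp_coeff_op_iff ψ _ g).2 (U.memLp_of_coeffGraph x)
  obtain ⟨c, hc, hsurj, hnorm⟩ := hU.norm_sq_intertwiner p (fun x y h => U.coeffGraph_ext h)
    (fun h => hφ₀ (DFunLike.congr_fun h (U.toCoeffGraph hm₀)))
    (fun g x => U.toCoeffGraph (hS g x))
    (fun g x => by
      obtain ⟨v, hv⟩ : ∃ v, U.op g v = x.1.fst := ⟨star (U.op g) x.1.fst, by
        rw [← mul_apply_eq_comp]; simp [op]⟩
      have hm : MemLp (U.coeff ψ v) 2 μ := by
        rw [← U.memLp_coeff_op_iff ψ v g, hv]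
        exact U.memLp_of_coeffGraph x
      exact ⟨U.toCoeffGraph hm, U.coeffGraph_ext hv⟩)
    (fun g x y => by
      rw [inner_coeffGraph, inner_coeffGraph, ← U.inner_op_op g x.1.fst,
        ← U.integral_coeff_op ψ x.1.fst _ g]
      rfl)
    (fun g x => rfl)
  -- The projection of the graph has `‖φ‖² = c ‖(φ, c_{ψ,φ})‖² = c (‖φ‖² + ∫ |c_{ψ,φ}|²)`.
  refine ⟨c⁻¹ - 1, fun φ => ?_⟩
  obtain ⟨x, rfl⟩ := hsurj φ
  refine ⟨U.memLp_of_coeffGraph x, ?_⟩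
  have h1 : ‖x‖ ^ 2 = ‖p x‖ ^ 2 + ∫ g, ‖U.coeff ψ (p x) g‖ ^ 2 ∂μ := by
    have h := U.inner_coeffGraph x x
    rw [inner_self_eq_norm_sq_to_K, inner_self_eq_norm_sq_to_K,
      integral_star_coeff_mul_self] at h
    have h2 := congrArg Complex.re h
    norm_cast at h2
  have h2 := hnorm x
  field_simp
  linear_combination -c * h1 - h2

/-- Inversion invariance makes `∫ |c_{ψ,φ}|²` symmetric in `ψ` and `φ`; so every vector is
admissible, and the integral, being a multiple of `‖φ‖²`, is a multiple of `‖ψ‖² ‖φ‖²`. -/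
theorem IsSquareIntegrable.exists_integral_norm_coeff [μ.IsMulLeftInvariant]
    [μ.IsInvInvariant] {U : ProjectiveRep G H} (hU : U.IsSquareIntegrable μ) :
    ∃ K : ℝ, ∀ ψ φ, MemLp (U.coeff ψ φ) 2 μ ∧
      ∫ g, ‖U.coeff ψ φ g‖ ^ 2 ∂μ = K * ‖ψ‖ ^ 2 * ‖φ‖ ^ 2 := by
  have := hU.1.1
  obtain ⟨φ₀, hφ₀⟩ := exists_ne (0 : H)
  have h0 : (0 : H) ∈ U.admissible μ := ⟨φ₀, hφ₀, by
    have : U.coeff 0 φ₀ = 0 := by simpa using U.coeff_smul_left 0 φ₀ 0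
    rw [this]
    exact MemLp.zero⟩
  obtain ⟨ψ₀, hψ₀, hne⟩ : ∃ ψ ∈ U.admissible μ, ψ ≠ 0 := by
    by_contra! h
    exact hU.2 (Set.Subset.antisymm h (Set.singleton_subset_iff.2 h0))
  obtain ⟨k₀, hk₀⟩ := hU.1.exists_integral_norm_coeff hψ₀
  have hadm : ∀ ψ, ψ ∈ U.admissible μ := fun ψ => ⟨ψ₀, hne, U.memLp_coeff_swap (hk₀ ψ).1⟩
  refine ⟨k₀ / ‖ψ₀‖ ^ 2, fun ψ φ => ?_⟩
  obtain ⟨k, hk⟩ := hU.1.exists_integral_norm_coeff (hadm ψ)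
  refine ⟨(hk φ).1, ?_⟩
  have hkk : k * ‖ψ₀‖ ^ 2 = k₀ * ‖ψ‖ ^ 2 := by
    rw [← (hk ψ₀).2, ← (hk₀ ψ).2, U.integral_norm_coeff_swap]
  have hpos : ‖ψ₀‖ ^ 2 ≠ 0 := by positivity
  rw [(hk φ).2]
  field_simp
  linear_combination ‖φ‖ ^ 2 * hkk

end Coeff

end ProjectiveRep

/-! ### Orthogonality relations -/

section Orthogonality

variable {H : Type*} [NormedAddCommGroup H] [InnerProductSpace ℂ H]

/-- A sesquilinear form vanishing on the diagonal vanishes. -/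
theorem eq_zero_of_sesquilinear_diag {b : H → H → ℂ}
    (add_left : ∀ x y z, b (x + y) z = b x z + b y z)
    (add_right : ∀ x y z, b x (y + z) = b x y + b x z)
    (smul_left : ∀ (c : ℂ) x y, b (c • x) y = star c * b x y)
    (smul_right : ∀ (c : ℂ) x y, b x (c • y) = c * b x y)
    (diag : ∀ x, b x x = 0) (x y : H) : b x y = 0 := by
  have h1 := diag (x + y)
  have h2 := diag (x + Complex.I • y)
  simp only [add_left, add_right, smul_left, smul_right, diag, RCLike.star_def,
    Complex.conj_I] at h1 h2
  linear_combination (1 / 2 : ℂ) * h1 + (-Complex.I / 2) * h2 +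
    (b x y / 2 - b y x / 2) * Complex.I_mul_I

variable [CompleteSpace H]

namespace ProjectiveRep

variable {G : Type*} [Group G] [MeasurableSpace G] {U : ProjectiveRep G H}
  {μ : Measure G}

/-- If `K` were not positive, then for almost every `g` all coordinates of `U(g) ψ` in a countable
basis would vanish, although `‖U(g) ψ‖ = ‖ψ‖`. -/
theorem pos_of_integral_norm_coeff [Nontrivial H] [TopologicalSpace.SeparableSpace H] [NeZero μ]
    {K : ℝ} (hK : ∀ ψ φ, MemLp (U.coeff ψ φ) 2 μ ∧
      ∫ g, ‖U.coeff ψ φ g‖ ^ 2 ∂μ = K * ‖ψ‖ ^ 2 * ‖φ‖ ^ 2) : 0 < K := by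
  by_contra! hK0
  obtain ⟨ψ, hψ⟩ := exists_ne (0 : H)
  let b := chosenBasis H
  have := b.countable_of_separableSpace
  have hae : ∀ k, ∀ᵐ g ∂μ, U.coeff ψ (b k) g = 0 := fun k => by
    have h0 : ∫ g, ‖U.coeff ψ (b k) g‖ ^ 2 ∂μ = 0 := by
      refine le_antisymm ?_ (integral_nonneg fun _ => by positivity)
      rw [(hK ψ (b k)).2, mul_assoc]
      exact mul_nonpos_of_nonpos_of_nonneg hK0 (by positivity)
    rw [integral_eq_zero_iff_of_nonneg (fun _ => by positivity)
      (by simpa using (hK ψ (b k)).1.integrable_norm_pow two_ne_zero)] at h0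
    filter_upwards [h0] with g hg
    simpa using hg
  obtain ⟨g, hg⟩ := (ae_all_iff.2 hae).exists
  have h := b.hasSum_norm_inner_sq (U.op g ψ)
  have hz : ∀ k, ‖⟪b k, U.op g ψ⟫_ℂ‖ ^ 2 = 0 := fun k => by
    rw [norm_inner_symm, show ⟪U.op g ψ, b k⟫_ℂ = 0 from hg k]
    simp
  simp only [hz, U.norm_op_apply] at h
  exact hψ (by simpa using h.unique hasSum_zero)

theorem integrable_star_coeff_mul {ψ₁ φ₁ ψ₂ φ₂ : H} (h₁ : MemLp (U.coeff ψ₁ φ₁) 2 μ)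
    (h₂ : MemLp (U.coeff ψ₂ φ₂) 2 μ) :
    Integrable (fun g => star (U.coeff ψ₁ φ₁ g) * U.coeff ψ₂ φ₂ g) μ :=
  h₁.star.integrable_mul h₂

/-- The orthogonality relations, by polarization first in `φ`, then in `ψ`. -/
theorem integral_star_coeff_mul {K : ℝ} (hK : ∀ ψ φ, MemLp (U.coeff ψ φ) 2 μ ∧
      ∫ g, ‖U.coeff ψ φ g‖ ^ 2 ∂μ = K * ‖ψ‖ ^ 2 * ‖φ‖ ^ 2) (φ₁ φ₂ ψ₁ ψ₂ : H) :
    ∫ g, star (U.coeff ψ₁ φ₁ g) * U.coeff ψ₂ φ₂ g ∂μ = K * ⟪φ₁, φ₂⟫_ℂ * ⟪ψ₂, ψ₁⟫_ℂ := by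
  have hint : ∀ ψ₁ φ₁ ψ₂ φ₂, Integrable (fun g => star (U.coeff ψ₁ φ₁ g) * U.coeff ψ₂ φ₂ g) μ :=
    fun ψ₁ φ₁ ψ₂ φ₂ => integrable_star_coeff_mul (hK ψ₁ φ₁).1 (hK ψ₂ φ₂).1
  have hdiag : ∀ ψ φ₁ φ₂, ∫ g, star (U.coeff ψ φ₁ g) * U.coeff ψ φ₂ g ∂μ =
      K * ⟪φ₁, φ₂⟫_ℂ * ⟪ψ, ψ⟫_ℂ := by
    intro ψ φ₁ φ₂
    rw [← sub_eq_zero]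
    refine eq_zero_of_sesquilinear_diag (b := fun φ₁ φ₂ =>
      ∫ g, star (U.coeff ψ φ₁ g) * U.coeff ψ φ₂ g ∂μ - K * ⟪φ₁, φ₂⟫_ℂ * ⟪ψ, ψ⟫_ℂ)
      ?_ ?_ ?_ ?_ ?_ φ₁ φ₂
    · intro x y z
      simp only [coeff_add_right, Pi.add_apply, star_add, add_mul, inner_add_left]
      rw [integral_add (hint _ _ _ _) (hint _ _ _ _)]
      ring
    · intro x y z
      simp only [coeff_add_right, Pi.add_apply, mul_add, inner_add_right]
      rw [integral_add (hint _ _ _ _) (hint _ _ _ _)]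
      ring
    · intro c x y
      simp only [coeff_smul_right, Pi.smul_apply, smul_eq_mul, star_mul', mul_assoc,
        inner_smul_left, integral_const_mul, RCLike.star_def]
      ring
    · intro c x y
      simp only [coeff_smul_right, Pi.smul_apply, smul_eq_mul, mul_left_comm _ c,
        inner_smul_right, integral_const_mul]
      ring
    · intro x
      rw [integral_star_coeff_mul_self, (hK ψ x).2, inner_self_eq_norm_sq_to_K,
        inner_self_eq_norm_sq_to_K]
      push_cast
      simp only [Complex.coe_algebraMap]
      ring
  rw [← sub_eq_zero]
  refine eq_zero_of_sesquilinear_diag (b := fun ψ₂ ψ₁ =>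
    ∫ g, star (U.coeff ψ₁ φ₁ g) * U.coeff ψ₂ φ₂ g ∂μ - K * ⟪φ₁, φ₂⟫_ℂ * ⟪ψ₂, ψ₁⟫_ℂ)
    ?_ ?_ ?_ ?_ ?_ ψ₂ ψ₁
  · intro x y z
    simp only [coeff_add_left, Pi.add_apply, mul_add, inner_add_left]
    rw [integral_add (hint _ _ _ _) (hint _ _ _ _)]
    ring
  · intro x y z
    simp only [coeff_add_left, Pi.add_apply, star_add, add_mul, inner_add_right]
    rw [integral_add (hint _ _ _ _) (hint _ _ _ _)]
    ring
  · intro c x y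
    simp only [coeff_smul_left, Pi.smul_apply, smul_eq_mul, mul_left_comm _ (star c),
      integral_const_mul]
    simp only [inner_smul_left, RCLike.star_def]
    ring
  · intro c x y
    simp only [coeff_smul_left, Pi.smul_apply, smul_eq_mul, star_mul', star_star, mul_assoc,
      inner_smul_right, integral_const_mul]
    ring
  · intro x
    rw [sub_eq_zero]
    exact hdiag x φ₁ φ₂

/-- Cauchy–Schwarz in `L²(G, μ)`. -/
theorem integral_norm_star_coeff_mul_le {K : ℝ} (hK : ∀ ψ φ, MemLp (U.coeff ψ φ) 2 μ ∧
      ∫ g, ‖U.coeff ψ φ g‖ ^ 2 ∂μ = K * ‖ψ‖ ^ 2 * ‖φ‖ ^ 2) (hK0 : 0 ≤ K) (φ₁ φ₂ ψ₁ ψ₂ : H) :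
    ∫ g, ‖star (U.coeff ψ₁ φ₁ g) * U.coeff ψ₂ φ₂ g‖ ∂μ ≤
      K * ((‖ψ₁‖ * ‖φ₁‖) * (‖ψ₂‖ * ‖φ₂‖)) := by
  have h := integral_mul_norm_le_Lp_mul_Lq (μ := μ) Real.HolderConjugate.two_two
    (f := U.coeff ψ₁ φ₁) (g := U.coeff ψ₂ φ₂) (by simpa using (hK ψ₁ φ₁).1)
    (by simpa using (hK ψ₂ φ₂).1)
  simp only [norm_mul, norm_star]
  refine h.trans_eq ?_
  simp only [Real.rpow_two, (hK _ _).2]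
  rw [← Real.sqrt_eq_rpow, ← Real.sqrt_eq_rpow, mul_assoc, mul_assoc, Real.sqrt_mul hK0,
    Real.sqrt_mul hK0, ← mul_pow, ← mul_pow, Real.sqrt_sq (by positivity),
    Real.sqrt_sq (by positivity)]
  linear_combination (‖ψ₁‖ * ‖φ₁‖ * (‖ψ₂‖ * ‖φ₂‖)) * Real.mul_self_sqrt hK0

end ProjectiveRep

end Orthogonality

/-! ### The Duflo–Moore operator -/

section DufloMoore

variable {H : Type*} [NormedAddCommGroup H] [InnerProductSpace ℂ H]

theorem scalarOperator_apply (d : ℝ) (x : (scalarOperator H d).domain) :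
    scalarOperator H d x = (d : ℂ) • (x : H) := rfl

variable [CompleteSpace H]

theorem isSelfAdjoint_scalarOperator (d : ℝ) : IsSelfAdjoint (scalarOperator H d) := by
  rw [LinearPMap.isSelfAdjoint_def]
  have h := ((d : ℂ) • (1 : H →L[ℂ] H)).toPMap_adjoint_eq_adjoint_toPMap_of_dense
    (p := ⊤) (by simp)
  have h2 : ((d : ℂ) • (1 : H →L[ℂ] H)).adjoint = (d : ℂ) • (1 : H →L[ℂ] H) := by
    rw [← ContinuousLinearMap.star_eq_adjoint]
    simp
  rw [h2] at h
  exact h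

/-- An everywhere defined positive symmetric `D` with `D² = d²` is `d`: as `(D + d) (D - d) = 0`,
the vector `z = (D - d) x` satisfies `⟪z, D z⟫ = - d ‖z‖²`, so `z = 0`. -/
theorem eq_scalarOperator {D : H →ₗ.[ℂ] H} {d : ℝ} (hd : 0 < d) (hsa : IsSelfAdjoint D)
    (hnonneg : ∀ ψ : D.domain, 0 ≤ RCLike.re ⟪(ψ : H), D ψ⟫_ℂ) (htop : D.domain = ⊤)
    (hD : ∀ x y : D.domain, ⟪D x, D y⟫_ℂ = (d : ℂ) ^ 2 * ⟪(x : H), y⟫_ℂ) :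
    D = scalarOperator H d := by
  have hmem : ∀ x : H, x ∈ D.domain := fun x => htop ▸ Submodule.mem_top
  have hsymm : ∀ x y : D.domain, ⟪D x, (y : H)⟫_ℂ = ⟪(x : H), D y⟫_ℂ := by
    have h := LinearPMap.adjoint_isFormalAdjoint hsa.dense_domain
    rw [LinearPMap.isSelfAdjoint_def.1 hsa] at h
    exact fun x y => h x y
  refine LinearPMap.ext htop fun x hx _ => ?_
  let z : D.domain := ⟨D ⟨x, hx⟩ - (d : ℂ) • x, hmem _⟩
  have hDD : D ⟨D ⟨x, hx⟩, hmem _⟩ = (d : ℂ) ^ 2 • x := by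
    refine ext_inner_right ℂ fun v => ?_
    rw [hsymm _ ⟨v, hmem v⟩, hD ⟨x, hx⟩ ⟨v, hmem v⟩, inner_smul_left]
    simp
  have hz : D z = -((d : ℂ) • (z : H)) := by
    have h1 : z = ⟨D ⟨x, hx⟩, hmem _⟩ - (d : ℂ) • ⟨x, hx⟩ := rfl
    have h2 : D z = (d : ℂ) ^ 2 • x - (d : ℂ) • D ⟨x, hx⟩ := by
      rw [h1, D.map_sub, D.map_smul, hDD]
    rw [h2]
    simp only [z]
    module
  have h := hnonneg z
  rw [hz, inner_neg_right, inner_smul_right, inner_self_eq_norm_sq_to_K] at h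
  have h3 : 0 ≤ -(d * ‖(z : H)‖ ^ 2) := by
    have : RCLike.re (-((d : ℂ) * ((‖(z : H)‖ : ℝ) : ℂ) ^ 2)) = -(d * ‖(z : H)‖ ^ 2) := by
      norm_cast
    rw [← this]
    exact h
  have h4 : ‖(z : H)‖ ^ 2 = 0 := by nlinarith [sq_nonneg ‖(z : H)‖]
  have h5 : (z : H) = 0 := by simpa using h4
  exact sub_eq_zero.1 h5

namespace ProjectiveRep

variable {G : Type*} [Group G] [MeasurableSpace G] {U : ProjectiveRep G H} {μ : Measure G}

/-- All vectors are admissible, and the orthogonality relations say `⟪D ψ₂, D ψ₁⟫ = d² ⟪ψ₂, ψ₁⟫`. -/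
theorem isDufloMoore_iff_eq_scalarOperator [Nontrivial H] {d : ℝ} (hd : 0 < d)
    (hK : ∀ ψ φ, MemLp (U.coeff ψ φ) 2 μ ∧
      ∫ g, ‖U.coeff ψ φ g‖ ^ 2 ∂μ = d ^ 2 * ‖ψ‖ ^ 2 * ‖φ‖ ^ 2) (D : H →ₗ.[ℂ] H) :
    U.IsDufloMoore μ D ↔ D = scalarOperator H d := by
  obtain ⟨φ₀, hφ₀⟩ := exists_ne (0 : H)
  have hadm : U.admissible μ = Set.univ :=
    Set.eq_univ_of_forall fun ψ => ⟨φ₀, hφ₀, (hK ψ φ₀).1⟩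
  have horth := integral_star_coeff_mul hK
  constructor
  · intro h
    have htop : D.domain = ⊤ := SetLike.coe_injective (by rw [h.domain_eq, hadm]; rfl)
    refine eq_scalarOperator hd h.selfAdjoint h.nonneg htop fun x y => ?_
    have h1 := (h.orthogonality φ₀ φ₀ y x).2
    rw [horth] at h1
    have h2 : ⟪φ₀, φ₀⟫_ℂ ≠ 0 := inner_self_ne_zero.2 hφ₀
    refine mul_left_cancel₀ h2 (h1.symm.trans ?_)
    push_cast
    ring
  · rintro rfl
    refine ⟨isSelfAdjoint_scalarOperator d, fun ψ => ?_, fun x y hxy => ?_, ?_, ?_⟩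
    · rw [scalarOperator_apply, inner_smul_right]
      have h0 : 0 ≤ d * (⟪(ψ : H), (ψ : H)⟫_ℂ).re :=
        mul_nonneg hd.le (inner_self_nonneg (𝕜 := ℂ))
      rw [← Complex.re_ofReal_mul] at h0
      exact h0
    · rw [scalarOperator_apply, scalarOperator_apply] at hxy
      exact Subtype.ext (smul_right_injective H (Complex.ofReal_ne_zero.2 hd.ne') hxy)
    · rw [hadm]
      rfl
    · intro φ₁ φ₂ ψ₁ ψ₂
      refine ⟨integrable_star_coeff_mul (hK _ _).1 (hK _ _).1, ?_⟩
      rw [horth, scalarOperator_apply, scalarOperator_apply, inner_smul_left, inner_smul_right,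
        Complex.conj_ofReal]
      push_cast
      ring

end ProjectiveRep

end DufloMoore

/-! ### Integrating the trace -/

section TraceFormula

theorem MeasureTheory.integrable_of_hasSum_of_summable_integral_norm {X ι : Type*} [Countable ι]
    [MeasurableSpace X] {μ : Measure X} {E : Type*} [NormedAddCommGroup E] {F : ι → X → E}
    {f : X → E} (hF : ∀ i, Integrable (F i) μ) (hs : Summable fun i => ∫ a, ‖F i a‖ ∂μ)
    (hf : ∀ a, HasSum (fun i => F i a) (f a)) : Integrable f μ := by
  refine ⟨aestronglyMeasurable_of_tendsto_ae (Filter.atTop : Filter (Finset ι))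
    (fun s => Finset.aestronglyMeasurable_fun_sum s fun i _ => (hF i).1) (.of_forall hf), ?_⟩
  have hle : ∀ a, ‖f a‖ₑ ≤ ∑' i, ‖F i a‖ₑ := fun a =>
    le_of_tendsto (continuous_enorm.continuousAt.tendsto.comp (hf a)) (.of_forall fun s =>
      (enorm_sum_le _ _).trans (ENNReal.sum_le_tsum s))
  refine (lintegral_mono hle).trans_lt ?_
  rw [lintegral_tsum fun i => (hF i).1.enorm]
  simp_rw [← ofReal_integral_norm_eq_lintegral_enorm (hF _)]
  rw [← ENNReal.ofReal_tsum_of_nonneg (fun _ => integral_nonneg fun _ => norm_nonneg _) hs]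
  exact ENNReal.ofReal_lt_top

namespace ProjectiveRep

variable {G H : Type*} [Group G] [MeasurableSpace G]
  [NormedAddCommGroup H] [InnerProductSpace ℂ H] [CompleteSpace H] (U : ProjectiveRep G H)
  {ι κ : Type*} {A T : H →L[ℂ] H} {x y : ι → H} {u v : κ → H}

/-- Trace class expansions are stable under multiplication by bounded operators:
`U T U* A = ∑ⱼ |U uⱼ⟩⟨A* U vⱼ|`. -/
theorem isNuclearExpansion_conj_mul (hT : IsNuclearExpansion T u v) (A : H →L[ℂ] H) (g : G) :
    IsNuclearExpansion (U.op g * T * star (U.op g) * A) (fun j => U.op g (u j))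
      (fun j => star A (U.op g (v j))) := by
  simpa using ((hT.mul_left (U.op g)).mul_right (star (U.op g))).mul_right A

theorem summable_norm_coeff_mul_coeff (hA : IsNuclearExpansion A x y)
    (hT : IsNuclearExpansion T u v) (g : G) :
    Summable fun p : κ × ι => ‖star (U.coeff (u p.1) (y p.2) g) * U.coeff (v p.1) (x p.2) g‖ := by
  refine .of_nonneg_of_le (fun _ => norm_nonneg _) (fun p => ?_)
    (hT.summable.mul_of_nonneg hA.summable (fun _ => by positivity) (fun _ => by positivity))
  rw [norm_mul, norm_star]
  calc ‖U.coeff (u p.1) (y p.2) g‖ * ‖U.coeff (v p.1) (x p.2) g‖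
      ≤ (‖u p.1‖ * ‖y p.2‖) * (‖v p.1‖ * ‖x p.2‖) := by
        gcongr <;> exact U.norm_coeff_le _ _ _
    _ = ‖u p.1‖ * ‖v p.1‖ * (‖x p.2‖ * ‖y p.2‖) := by ring

theorem opTrace_conj_mul (hA : IsNuclearExpansion A x y) (hT : IsNuclearExpansion T u v) (g : G) :
    opTrace (U.op g * T * star (U.op g) * A) =
      ∑' p : κ × ι, star (U.coeff (u p.1) (y p.2) g) * U.coeff (v p.1) (x p.2) g := by
  rw [(U.isNuclearExpansion_conj_mul hT A g).opTrace_eq,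
    (U.summable_norm_coeff_mul_coeff hA hT g).of_norm.tsum_prod]
  refine tsum_congr fun j => (HasSum.tsum_eq ?_).symm
  have h := (innerSL ℂ (U.op g (v j))).hasSum (hA.hasSum (U.op g (u j)))
  rw [ContinuousLinearMap.star_eq_adjoint, ContinuousLinearMap.adjoint_inner_left]
  simpa [coeff, inner_smul_right] using h

variable {U} {μ : Measure G}

/-- Expanding `A = ∑ᵢ |xᵢ⟩⟨yᵢ|` and `T = ∑ⱼ |uⱼ⟩⟨vⱼ|` turns the trace formula into the sum over
`i`, `j` of orthogonality relations. -/
theorem integral_opTrace_conj_mul [Countable ι] [Countable κ] {K : ℝ} (hK0 : 0 ≤ K)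
    (hK : ∀ ψ φ, MemLp (U.coeff ψ φ) 2 μ ∧
      ∫ g, ‖U.coeff ψ φ g‖ ^ 2 ∂μ = K * ‖ψ‖ ^ 2 * ‖φ‖ ^ 2)
    (hA : IsNuclearExpansion A x y) (hT : IsNuclearExpansion T u v) :
    Integrable (fun g => opTrace (U.op g * T * star (U.op g) * A)) μ ∧
      ∫ g, opTrace (U.op g * T * star (U.op g) * A) ∂μ = K * (opTrace A * opTrace T) := by
  simp_rw [U.opTrace_conj_mul hA hT]
  have hint : ∀ p : κ × ι, Integrable
      (fun g => star (U.coeff (u p.1) (y p.2) g) * U.coeff (v p.1) (x p.2) g) μ :=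
    fun p => integrable_star_coeff_mul (hK _ _).1 (hK _ _).1
  have hsum : Summable fun p : κ × ι =>
      ∫ g, ‖star (U.coeff (u p.1) (y p.2) g) * U.coeff (v p.1) (x p.2) g‖ ∂μ := by
    refine .of_nonneg_of_le (fun _ => integral_nonneg fun _ => norm_nonneg _)
      (fun p => (integral_norm_star_coeff_mul_le hK hK0 _ _ _ _).trans_eq ?_)
      ((hT.summable.mul_of_nonneg hA.summable (fun _ => by positivity)
        (fun _ => by positivity)).mul_left K)
    ring
  refine ⟨integrable_of_hasSum_of_summable_integral_norm hint hsum fun g =>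
    (U.summable_norm_coeff_mul_coeff hA hT g).of_norm.hasSum, ?_⟩
  have h := (hasSum_integral_of_summable_integral_norm hint hsum).tsum_eq
  rw [← h]
  simp_rw [integral_star_coeff_mul hK]
  rw [hA.opTrace_eq, hT.opTrace_eq, mul_comm (∑' i, _),
    tsum_mul_tsum_of_summable_norm hT.summable_inner hA.summable_inner, ← tsum_mul_left]
  refine tsum_congr fun p => ?_
  ring

end ProjectiveRep

end TraceFormula

theorem mainTheorem4 {G H : Type*} [Group G] [TopologicalSpace G] [IsTopologicalGroup G]
    [LocallyCompactSpace G] [SecondCountableTopology G] [T2Space G]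
    [MeasurableSpace G] [BorelSpace G]
    [NormedAddCommGroup H] [InnerProductSpace ℂ H] [CompleteSpace H]
    [TopologicalSpace.SeparableSpace H]
    (μ : Measure G) [μ.IsHaarMeasure]
    (hG : ∀ g : G, Measure.modularCharacter g = 1)
    (U : ProjectiveRep G H) (hU : U.IsSquareIntegrable μ) :
    ∃ d : ℝ, 0 < d ∧
      (∀ D : H →ₗ.[ℂ] H, U.IsDufloMoore μ D ↔ D = scalarOperator H d) ∧
      ∀ A T : H →L[ℂ] H, IsTraceClass A → IsTraceClass T →
        (∀ g : G, IsTraceClass (U.op g * T * star (U.op g) * A)) ∧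
        Integrable (fun g => opTrace (U.op g * T * star (U.op g) * A)) μ ∧
        opTrace A * opTrace T =
          ((d ^ 2)⁻¹ : ℂ) * ∫ g, opTrace (U.op g * T * star (U.op g) * A) ∂μ := by
  have := hU.1.1
  have := μ.isMulRightInvariant_of_modularCharacter_eq_one hG
  have := μ.isInvInvariant_of_isMulRightInvariant
  have := (chosenBasis H).countable_of_separableSpace
  obtain ⟨K, hK⟩ := hU.exists_integral_norm_coeff
  have hK0 : 0 < K := ProjectiveRep.pos_of_integral_norm_coeff hK
  have hd2 : √K ^ 2 = K := Real.sq_sqrt hK0.le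
  refine ⟨√K, Real.sqrt_pos.2 hK0, ProjectiveRep.isDufloMoore_iff_eq_scalarOperator
    (Real.sqrt_pos.2 hK0) (by rwa [hd2]), fun A T hA hT => ?_⟩
  obtain ⟨x, y, hA⟩ := hA.exists_isNuclearExpansion
  obtain ⟨u, v, hT⟩ := hT.exists_isNuclearExpansion
  obtain ⟨hint, heq⟩ := ProjectiveRep.integral_opTrace_conj_mul hK0.le hK hA hT
  refine ⟨fun g => (U.isNuclearExpansion_conj_mul hT A g).isTraceClass, hint, ?_⟩
  have hKC : (K : ℂ) ≠ 0 := Complex.ofReal_ne_zero.2 hK0.ne'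
  rw [heq, ← Complex.ofReal_pow, hd2, inv_mul_cancel_left₀ hKC]
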